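/- Let $k$ be an algebraically closed field of arbitrary characteristic, and let $X$ and $Y$ be irreducible affine varieties over $k$, identified with their sets of $k$-points. Let $\phi\colon X\to Y$ be a dominant morphism that is quasi-finite (every fibre $\phi^{-1}(y)$, $y\in Y$, is a finite set). Suppose that $Y$ is normal and that generic fibres of $\phi$ are singletons, i.e. there is a dense open subset $V\subseteq Y$ such that $\phi^{-1}(y)$ consists of exactly one point for every $y\in V$. Then $\phi$ is a finite bijection onto an open subvariety of $Y$: there is an affine open subvariety $U\subseteq Y$ with $\phi(X)=U$ such that the induced morphism $X\to U$ is finite (i.e. $k[X]$ is integral over the image of $k[U]$) and bijective. Moreover, let $\widetilde{X}$ be the normalization of $X$, that is, the affine variety whose coordinate ring is the integral closure of $k[X]$ in the function field $k(X)$; then the normalization map $\nu_X\colon \widetilde{X}\to X$, whose comorphism is the inclusion $k[X]\subseteq k[\widetilde{X}]$, is a bijection. -/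

import Mathlib

open CategoryTheory AlgebraicGeometry

universe u

/-- The `k`-points of a `k`-scheme `X` with structure morphism `s : X ⟶ Spec k`. A variety is
identified with its set of `k`-points. -/
def KPoint {k : Type u} [Field k] {X : Scheme.{u}} (s : X ⟶ Spec (CommRingCat.of k)) : Type u :=
  {p : Spec (CommRingCat.of k) ⟶ X // p ≫ s = 𝟙 (Spec (CommRingCat.of k))}

/-- The map on `k`-points induced by a morphism `f` of `k`-schemes. -/
noncomputable def KPoint.map {k : Type u} [Field k] {X Y : Scheme.{u}} {s : X ⟶ Spec (CommRingCat.of k)}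
    {t : Y ⟶ Spec (CommRingCat.of k)} (f : X ⟶ Y) (hf : f ≫ t = s) (p : KPoint s) : KPoint t :=
  ⟨p.1 ≫ f, by rw [Category.assoc, hf, p.2]⟩

/-- The point of the underlying topological space of `X` given by a `k`-point. -/
noncomputable def KPoint.toPoint {k : Type u} [Field k] {X : Scheme.{u}}
    {s : X ⟶ Spec (CommRingCat.of k)} (p : KPoint s) : X :=
  p.1 (IsLocalRing.closedPoint k)

/-- The fibre of `f` over a `k`-point `q` of `Y`, as a set of `k`-points of `X`. -/
def KPoint.fibre {k : Type u} [Field k] {X Y : Scheme.{u}} {s : X ⟶ Spec (CommRingCat.of k)}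
    {t : Y ⟶ Spec (CommRingCat.of k)} (f : X ⟶ Y) (hf : f ≫ t = s) (q : KPoint t) :
    Set (KPoint s) :=
  {p | p.map f hf = q}

/-- A scheme is normal if all its local rings are integrally closed domains. -/
def IsNormalScheme (X : Scheme.{u}) : Prop :=
  ∀ x : X, IsDomain (X.presheaf.stalk x) ∧ IsIntegrallyClosed (X.presheaf.stalk x)

instance nonempty_top_opens_of_isIntegral (X : Scheme.{u}) [AlgebraicGeometry.IsIntegral X] :
    Nonempty (⊤ : X.Opens) :=
  ⟨⟨genericPoint X, trivial⟩⟩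

/-- The coordinate ring of the normalization of an irreducible affine variety `X`: the integral
closure of the coordinate ring of `X` in the function field of `X`. -/
noncomputable abbrev normalizationRing (X : Scheme.{u}) [AlgebraicGeometry.IsIntegral X] :
    Subalgebra Γ(X, ⊤) X.functionField :=
  integralClosure Γ(X, ⊤) X.functionField

/-- The normalization of an irreducible affine variety `X`. -/
noncomputable def affineNormalization (X : Scheme.{u}) [AlgebraicGeometry.IsIntegral X] : Scheme.{u} :=
  Spec (CommRingCat.of (normalizationRing X))

/-- The normalization map of an irreducible affine variety `X`; its comorphism is the inclusion of
the coordinate ring of `X` in its integral closure. -/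
noncomputable def affineNormalizationMap (X : Scheme.{u}) [AlgebraicGeometry.IsIntegral X]
    [IsAffine X] :
    affineNormalization X ⟶ X :=
  Spec.map (CommRingCat.ofHom (algebraMap Γ(X, ⊤) (normalizationRing X))) ≫ X.isoSpec.inv

/-! Write `A = k[Y]`, `B = k[X]`, with fraction fields `K ⊆ L`, and let `p` be the characteristic
exponent. Generic injectivity makes `L/K` purely inseparable: two distinct `K`-embeddings of `L`
would specialise to two distinct points in one generic fibre
(`isPurelyInseparable_of_generically_injective`).

The image of `X` is the spectrum of `C = B ∩ K`. Every element of `B` has a `p`-power power in `C`,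
so `Spec B → Spec C` is finite and bijective on points. At a maximal ideal `q` of `B`, Zariski's
main theorem gives `r ∉ q` integral over `A` whose powers make every element of `B` integral over
`A`. Some `g = r ^ p ^ n` lies in `K`, hence in `A` by normality; for the same reason powers of `g`
carry `C` into `A`. So `C` is locally a localization of `A`, and `Spec C → Y` is an open immersion.

The same denominators show that an element of `K` integral over `B` lies in `B`
(`mem_range_of_isIntegral_of_zariskisMain`). Hence every element of the normalization has a
`p`-power power in `B`, and `bijective_comp_of_pow_mem_range` applies again. -/

open scoped TensorProduct

/-! ### Nullstellensatz -/

/-- A maximal ideal of an algebra of finite type over an algebraically closed field is the kernel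
of a point. -/
theorem exists_algHom_ker_eq_of_isMaximal {k R : Type*} [Field k] [IsAlgClosed k] [CommRing R]
    [Algebra k R] [Algebra.FiniteType k R] (q : Ideal R) [hq : q.IsMaximal] :
    ∃ χ : R →ₐ[k] k, RingHom.ker χ = q := by
  let := Ideal.Quotient.field q
  have : Algebra.FiniteType k (R ⧸ q) :=
    .of_surjective (Ideal.Quotient.mkₐ k q) Ideal.Quotient.mk_surjective
  have : Module.Finite k (R ⧸ q) := finite_of_finite_type_of_isJacobsonRing k (R ⧸ q)
  let e : k ≃ₐ[k] (R ⧸ q) := AlgEquiv.ofBijective (Algebra.ofId k (R ⧸ q))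
    IsAlgClosed.algebraMap_bijective_of_isIntegral
  refine ⟨e.symm.toAlgHom.comp (Ideal.Quotient.mkₐ k q), ?_⟩
  ext x
  simp [RingHom.mem_ker, Ideal.Quotient.eq_zero_iff_mem]

/-- The kernel of a point is maximal. -/
theorem AlgHom.ker_isMaximal_of_field {k R : Type*} [Field k] [CommRing R] [Algebra k R]
    (χ : R →ₐ[k] k) : (RingHom.ker χ).IsMaximal :=
  RingHom.ker_isMaximal_of_surjective χ fun c ↦ ⟨algebraMap k R c, by simp⟩

/-- A point is determined by its kernel. -/
theorem AlgHom.eq_of_ker_le {k R : Type*} [Field k] [CommRing R] [Algebra k R]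
    {χ ξ : R →ₐ[k] k} (h : RingHom.ker χ ≤ RingHom.ker ξ) : χ = ξ := by
  ext x
  have : x - algebraMap k R (χ x) ∈ RingHom.ker χ := by simp [RingHom.mem_ker]
  have := h this
  rw [RingHom.mem_ker, map_sub, AlgHom.commutes, sub_eq_zero] at this
  exact this.symm

/-- Nullstellensatz: a function that does not vanish on an irreducible closed subset is nonzero at
some point of it. -/
theorem exists_algHom_ne_zero_of_notMem {k R : Type*} [Field k] [IsAlgClosed k] [CommRing R]
    [Algebra k R] [Algebra.FiniteType k R] (P : Ideal R) [hP : P.IsPrime] {e : R} (he : e ∉ P) :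
    ∃ χ : R →ₐ[k] k, P ≤ RingHom.ker χ ∧ χ e ≠ 0 := by
  have : IsJacobsonRing R := isJacobsonRing_of_finiteType (A := k)
  have h : e ∉ P.jacobson := by
    rwa [IsJacobsonRing.out inferInstance hP.isRadical]
  simp only [Ideal.jacobson, Ideal.mem_sInf, not_forall] at h
  obtain ⟨q, ⟨hPq, hq⟩, heq⟩ := h
  obtain ⟨χ, rfl⟩ := exists_algHom_ker_eq_of_isMaximal (k := k) q
  exact ⟨χ, hPq, heq⟩

/-! ### Finite fibres and Zariski's main theorem -/

/-- If every fibre over a `k`-point is finite, then the algebra is quasi-finite at every maximal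
ideal. -/
theorem quasiFiniteAt_of_finite_fibres {k A B : Type*} [Field k] [IsAlgClosed k] [CommRing A]
    [CommRing B] [Algebra k A] [Algebra k B] [Algebra A B] [IsScalarTower k A B]
    [Algebra.FiniteType k B]
    (hfin : ∀ y : A →ₐ[k] k, {x : B →ₐ[k] k | ∀ a, x (algebraMap A B a) = y a}.Finite)
    (q : Ideal B) [hq : q.IsMaximal] : Algebra.QuasiFiniteAt A q := by
  have : Algebra.FiniteType A B := .of_restrictScalars_finiteType k A B
  have : IsJacobsonRing B := isJacobsonRing_of_finiteType (A := k)
  let Q : PrimeSpectrum B := ⟨q, hq.isPrime⟩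
  refine Algebra.QuasiFiniteAt.of_isOpen_singleton_fiber (R := A) Q ?_
  obtain ⟨χ, hχ⟩ := exists_algHom_ker_eq_of_isMaximal (k := k) q
  let y : A →ₐ[k] k := χ.comp (IsScalarTower.toAlgHom k A B)
  have hy : RingHom.ker y = q.comap (algebraMap A B) := by
    rw [← hχ]; ext a; simp [RingHom.mem_ker, y]
  let F : Set (PrimeSpectrum B) :=
    PrimeSpectrum.comap (algebraMap A B) ⁻¹' {Q.comap (algebraMap A B)}
  have hmax : (Q.comap (algebraMap A B)).asIdeal.IsMaximal := by
    change (q.comap (algebraMap A B)).IsMaximal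
    rw [← hy]; exact y.ker_isMaximal_of_field
  -- The fibre is closed, hence a Jacobson space. Its closed points come from `k`-points over `y`,
  -- so there are finitely many, and such a Jacobson space is discrete.
  have hF : IsClosed F :=
    ((PrimeSpectrum.isClosed_singleton_iff_isMaximal _).mpr hmax).preimage
      (PrimeSpectrum.continuous_comap _)
  have : JacobsonSpace F := .of_isClosedEmbedding hF.isClosedEmbedding_subtypeVal
  have hclosed : (closedPoints F).Finite := by
    refine Set.Finite.of_finite_image (f := fun z : F ↦ z.1.asIdeal) ?_
      (fun a _ b _ h ↦ Subtype.ext (PrimeSpectrum.ext h))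
    refine ((hfin y).image fun x ↦ RingHom.ker x).subset ?_
    rintro _ ⟨z, hz, rfl⟩
    rw [← hF.isClosedEmbedding_subtypeVal.preimage_closedPoints, Set.mem_preimage,
      mem_closedPoints_iff, PrimeSpectrum.isClosed_singleton_iff_isMaximal] at hz
    obtain ⟨ξ, hξ⟩ := exists_algHom_ker_eq_of_isMaximal (k := k) z.1.asIdeal
    refine ⟨ξ, fun a ↦ ?_, hξ⟩
    have hz2 : z.1.asIdeal.comap (algebraMap A B) = q.comap (algebraMap A B) :=
      congrArg PrimeSpectrum.asIdeal z.2
    have : y = ξ.comp (IsScalarTower.toAlgHom k A B) := by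
      refine AlgHom.eq_of_ker_le ?_
      rw [hy, ← hz2, ← hξ]
      intro a ha
      simpa [RingHom.mem_ker] using ha
    rw [this]; rfl
  have : DiscreteTopology F := JacobsonSpace.discreteTopology hclosed
  exact isOpen_discrete _

/-- Zariski's main theorem at the maximal ideals of an algebra with finite fibres. -/
theorem exists_isIntegral_of_finite_fibres {k A B : Type*} [Field k] [IsAlgClosed k] [CommRing A]
    [CommRing B] [Algebra k A] [Algebra k B] [Algebra A B] [IsScalarTower k A B]
    [Algebra.FiniteType k B]
    (hfin : ∀ y : A →ₐ[k] k, {x : B →ₐ[k] k | ∀ a, x (algebraMap A B a) = y a}.Finite)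
    (q : Ideal B) [hq : q.IsMaximal] :
    ∃ r ∉ q, IsIntegral A r ∧ ∀ b : B, ∃ m : ℕ, IsIntegral A (r ^ m * b) := by
  have : Algebra.FiniteType A B := .of_restrictScalars_finiteType k A B
  have := quasiFiniteAt_of_finite_fibres hfin q
  exact Algebra.zariskisMainProperty_iff.mp (.of_finiteType (R := A) q)

/-! ### Pure inseparability of the function field extension -/

/-- If the generic fibres have at most one point, then the extension of function fields is purely
inseparable. -/
theorem isPurelyInseparable_of_generically_injective {k A B K L : Type*} [Field k] [IsAlgClosed k]
    [CommRing A] [CommRing B] [Algebra k A] [Algebra k B] [Algebra A B] [IsScalarTower k A B]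
    [Algebra.FiniteType k B] [Field K] [Field L] [Algebra A K] [Algebra A L]
    [Algebra B L] [Algebra K L] [IsScalarTower A K L] [IsScalarTower A B L]
    [IsFractionRing B L] (hinj : Function.Injective (algebraMap A B))
    (g : A) (hg : g ≠ 0)
    (hgen : ∀ x x' : B →ₐ[k] k, (∀ a, x (algebraMap A B a) = x' (algebraMap A B a)) →
      x (algebraMap A B g) ≠ 0 → x = x') :
    IsPurelyInseparable K L := by
  -- This criterion yields algebraicity of `L/K` as well.
  rw [isPurelyInseparable_iff_subsingleton_emb]
  refine ⟨fun σ τ ↦ ?_⟩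
  let Ω := AlgebraicClosure L
  have key : σ.toRingHom = τ.toRingHom := by
    refine IsLocalization.ringHom_ext (nonZeroDivisors B) ?_
    by_contra hne
    obtain ⟨b, hb⟩ : ∃ b : B, σ (algebraMap B L b) ≠ τ (algebraMap B L b) := by
      by_contra! h
      exact hne (RingHom.ext h)
    have hA (a : A) : σ (algebraMap B L (algebraMap A B a)) =
        τ (algebraMap B L (algebraMap A B a)) := by
      rw [← IsScalarTower.algebraMap_apply A B L, IsScalarTower.algebraMap_apply A K L,
        AlgHom.commutes, AlgHom.commutes]
    -- The `k`-structure on `Ω` is taken through `σ`; `τ` respects it because both agree on `A`.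
    let : Algebra k Ω :=
      (((σ : L →+* Ω).comp (algebraMap B L)).comp (algebraMap k B)).toAlgebra
    let f : B →ₐ[k] Ω := ⟨(σ : L →+* Ω).comp (algebraMap B L), fun c ↦ rfl⟩
    let f' : B →ₐ[k] Ω := ⟨(τ : L →+* Ω).comp (algebraMap B L), fun c ↦ by
      change τ (algebraMap B L (algebraMap k B c)) = σ (algebraMap B L (algebraMap k B c))
      rw [IsScalarTower.algebraMap_apply k A B]
      exact (hA _).symm⟩
    have : Algebra.FiniteType k (B ⊗[k] B) :=
      .trans (S := B) inferInstance inferInstance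
    let F : B ⊗[k] B →ₐ[k] Ω := Algebra.TensorProduct.lift f f' fun _ _ ↦ .all _ _
    let i₁ : B →ₐ[k] B ⊗[k] B := Algebra.TensorProduct.includeLeft
    let i₂ : B →ₐ[k] B ⊗[k] B := Algebra.TensorProduct.includeRight
    have h₁ (x : B) : F (i₁ x) = f x := by
      change Algebra.TensorProduct.lift f f' _ (x ⊗ₜ 1) = _
      rw [Algebra.TensorProduct.lift_tmul, map_one, mul_one]
    have h₂ (x : B) : F (i₂ x) = f' x := by
      change Algebra.TensorProduct.lift f f' _ (1 ⊗ₜ x) = _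
      rw [Algebra.TensorProduct.lift_tmul, map_one, one_mul]
    have : (RingHom.ker F).IsPrime := RingHom.ker_isPrime _
    -- A `k`-point of `B ⊗ B` killing `ker F` is a pair of points of `X` with the same image in `Y`.
    -- Nonvanishing of this element separates the pair at `b` and puts it over the locus `g ≠ 0`.
    have he : (i₁ b - i₂ b) * i₁ (algebraMap A B g) ∉ RingHom.ker F := by
      rw [RingHom.mem_ker, map_mul, map_sub, h₁, h₂, h₁]
      refine mul_ne_zero (sub_ne_zero.mpr hb) ?_
      have hfi : Function.Injective f :=
        (σ : L →+* Ω).injective.comp (IsFractionRing.injective B L)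
      rw [ne_eq, map_eq_zero_iff f hfi, map_eq_zero_iff _ hinj]
      exact hg
    obtain ⟨χ, hχ, hχe⟩ := exists_algHom_ne_zero_of_notMem (k := k) _ he
    rw [map_mul, map_sub] at hχe
    refine left_ne_zero_of_mul hχe (sub_eq_zero.mpr ?_)
    refine DFunLike.congr_fun (hgen (χ.comp i₁) (χ.comp i₂) (fun a ↦ ?_)
      (right_ne_zero_of_mul hχe)) b
    have : i₁ (algebraMap A B a) - i₂ (algebraMap A B a) ∈ RingHom.ker F := by
      rw [RingHom.mem_ker, map_sub, h₁, h₂, sub_eq_zero]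
      exact hA a
    have := hχ this
    rwa [RingHom.mem_ker, map_sub, sub_eq_zero] at this
  exact AlgHom.ext fun x ↦ RingHom.congr_fun key x

/-! ### Powers and denominators in integral extensions -/

/-- Restriction of points along an extension `R ⊆ S` such that every element of `S` has a power,
with exponent a power of the characteristic exponent, in `R`. -/
theorem bijective_comp_of_pow_mem_range {k R S : Type*} [Field k] [IsAlgClosed k] (p : ℕ)
    [ExpChar k p] [CommRing R] [CommRing S] [Algebra k R] [Algebra k S] (f : R →ₐ[k] S)
    (hf : Function.Injective f) (hpow : ∀ s : S, ∃ n : ℕ, s ^ p ^ n ∈ f.range) :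
    Function.Bijective fun χ : S →ₐ[k] k ↦ χ.comp f := by
  constructor
  · intro χ ξ h
    ext s
    obtain ⟨n, r, hr⟩ := hpow s
    have h : χ (f r) = ξ (f r) := DFunLike.congr_fun h r
    replace hr : f r = s ^ p ^ n := hr
    rw [hr, map_pow, map_pow] at h
    exact iterateFrobenius_inj k p n h
  · intro χ
    let := f.toRingHom.toAlgebra
    have : IsScalarTower k R S := .of_algebraMap_eq fun c ↦ (f.commutes c).symm
    have : Algebra.IsIntegral R S := ⟨fun s ↦ by
      obtain ⟨n, r, hr⟩ := hpow s
      refine IsIntegral.of_pow (expChar_pow_pos k p n) ?_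
      rw [← hr]
      exact isIntegral_algebraMap⟩
    have hker := χ.ker_isMaximal_of_field
    obtain ⟨Q, hQ, hQ'⟩ := Ideal.exists_ideal_over_maximal_of_isIntegral (S := S)
      (RingHom.ker χ) (by
        rw [(RingHom.injective_iff_ker_eq_bot (algebraMap R S)).mp hf]; exact bot_le)
    let := Ideal.Quotient.field Q
    have hχ (r : R) : algebraMap k (S ⧸ Q) (χ r) = Ideal.Quotient.mk Q (f r) := by
      rw [← Ideal.Quotient.mk_algebraMap, Ideal.Quotient.eq, ← f.commutes, ← map_sub]
      change _ ∈ Q.comap (algebraMap R S)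
      rw [hQ', RingHom.mem_ker]
      simp
    -- `S` need not be of finite type, so the residue field is shown to be `k` by integrality:
    -- suitable powers come from `R`, which acts through `χ`.
    have : Algebra.IsIntegral k (S ⧸ Q) := ⟨fun s ↦ by
      obtain ⟨s, rfl⟩ := Ideal.Quotient.mk_surjective s
      obtain ⟨n, r, hr⟩ := hpow s
      replace hr : f r = s ^ p ^ n := hr
      refine IsIntegral.of_pow (expChar_pow_pos k p n) ?_
      rw [← map_pow, ← hr, ← hχ]
      exact isIntegral_algebraMap⟩
    let e : k ≃ₐ[k] (S ⧸ Q) := AlgEquiv.ofBijective (Algebra.ofId k (S ⧸ Q))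
      IsAlgClosed.algebraMap_bijective_of_isIntegral
    refine ⟨e.symm.toAlgHom.comp (Ideal.Quotient.mkₐ k Q), AlgHom.ext fun r ↦ ?_⟩
    change e.symm (Ideal.Quotient.mk Q (f r)) = χ r
    rw [← hχ]
    exact e.symm_apply_apply (χ r)

/-- If every element of `S` becomes an element of `R` after multiplication with a power of `g`, then
every element that is integral over `S` becomes integral over `R` after multiplication with a power
of `g`. -/
theorem IsIntegral.exists_pow_mul_of_forall_pow_mul_mem_range {R S T : Type*} [CommRing R]
    [CommRing S] [CommRing T] [Algebra R S] [Algebra S T] [Algebra R T] [IsScalarTower R S T]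
    (g : R) (h : ∀ s : S, ∃ m : ℕ, algebraMap R S g ^ m * s ∈ (algebraMap R S).range) {x : T}
    (hx : IsIntegral S x) : ∃ N : ℕ, IsIntegral R (algebraMap R T g ^ N * x) := by
  nontriviality T
  have : Nontrivial S := (algebraMap S T).domain_nontrivial
  obtain ⟨P, hP, hPx⟩ := hx
  choose m hm using h
  -- Scaling roots by `g ^ N` multiplies the `i`-th coefficient by `g ^ (N * (deg - i))`: at least
  -- `g ^ N` below the leading term, which stays `1`.
  let N := P.support.sup fun i ↦ m (P.coeff i)
  refine ⟨N, ?_⟩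
  let Q := P.scaleRoots (algebraMap R S g ^ N)
  have hQ : Q.Monic := (Polynomial.monic_scaleRoots_iff _).mpr hP
  have hQl : Q ∈ Polynomial.lifts (algebraMap R S) := by
    rw [Polynomial.lifts_iff_coeff_lifts]
    intro i
    rw [Polynomial.coeff_scaleRoots]
    by_cases hi : i ∈ P.support
    swap
    · rw [Polynomial.notMem_support_iff.mp hi, zero_mul]
      exact ⟨0, map_zero _⟩
    rcases eq_or_lt_of_le (Polynomial.le_natDegree_of_mem_supp i hi) with rfl | hlt
    · rw [Polynomial.Monic.coeff_natDegree hP, Nat.sub_self, pow_zero, one_mul]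
      exact ⟨1, map_one _⟩
    · have hle : m (P.coeff i) ≤ N * (P.natDegree - i) :=
        (Finset.le_sup (f := fun i ↦ m (P.coeff i)) hi).trans
          (Nat.le_mul_of_pos_right _ (by omega))
      obtain ⟨a, ha⟩ := hm (P.coeff i)
      refine ⟨g ^ (N * (P.natDegree - i) - m (P.coeff i)) * a, ?_⟩
      rw [map_mul, ha, map_pow, ← mul_assoc, ← pow_add, Nat.sub_add_cancel hle, pow_mul, mul_comm]
  obtain ⟨Q', hQ', -, hQ'm⟩ := Polynomial.lifts_and_natDegree_eq_and_monic hQl hQ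
  refine ⟨Q', hQ'm, ?_⟩
  have h0 := Polynomial.scaleRoots_eval₂_eq_zero (algebraMap S T) (s := algebraMap R S g ^ N) hPx
  change Polynomial.eval₂ _ _ Q = 0 at h0
  rwa [← hQ', Polynomial.eval₂_map, map_pow, ← IsScalarTower.algebraMap_apply,
    ← IsScalarTower.algebraMap_eq] at h0

/-! ### The ring `C = B ∩ K` -/

section FractionFieldInter

variable (A B K L : Type*) [CommRing A] [CommRing B] [Field K] [Field L] [Algebra A B]
  [Algebra A K] [Algebra A L] [Algebra B L] [Algebra K L] [IsScalarTower A K L]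
  [IsScalarTower A B L]

/-- The subring of the elements of `B` that lie in the subfield `K` of `L`. -/
def fractionFieldInter : Subalgebra A B :=
  (IsScalarTower.toAlgHom A K L).range.comap (IsScalarTower.toAlgHom A B L)

variable {A B K L}

theorem mem_fractionFieldInter {b : B} :
    b ∈ fractionFieldInter A B K L ↔ algebraMap B L b ∈ (algebraMap K L).range :=
  Iff.rfl

/-- This is how normality of `Y` is used throughout. -/
theorem mem_range_of_isIntegral_of_mem_range [IsDomain A] [IsIntegrallyClosed A]
    [IsFractionRing A K] {x : L} (hx : x ∈ (algebraMap K L).range) (hint : IsIntegral A x) :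
    x ∈ (algebraMap A L).range := by
  obtain ⟨c, rfl⟩ := hx
  rw [isIntegral_algebraMap_iff (algebraMap K L).injective] at hint
  obtain ⟨a, rfl⟩ := IsIntegrallyClosed.isIntegral_iff.mp hint
  exact ⟨a, IsScalarTower.algebraMap_apply A K L a⟩

theorem exists_pow_mem_fractionFieldInter (p : ℕ) [ExpChar K p] [IsPurelyInseparable K L]
    (b : B) : ∃ n : ℕ, b ^ p ^ n ∈ fractionFieldInter A B K L := by
  obtain ⟨n, hn⟩ := IsPurelyInseparable.pow_mem K p (algebraMap B L b)
  exact ⟨n, by rwa [mem_fractionFieldInter, map_pow]⟩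

theorem isIntegral_fractionFieldInter [IsPurelyInseparable K L] :
    Algebra.IsIntegral (fractionFieldInter A B K L) B := by
  refine ⟨fun b ↦ ?_⟩
  obtain ⟨n, hn⟩ := exists_pow_mem_fractionFieldInter (A := A) (K := K) (L := L)
    (ringExpChar K) b
  refine IsIntegral.of_pow (expChar_pow_pos K (ringExpChar K) n) ?_
  exact isIntegral_algebraMap (x := (⟨_, hn⟩ : fractionFieldInter A B K L))

variable [IsDomain A] [IsIntegrallyClosed A] [IsFractionRing A K]
  [IsFractionRing B L] [IsPurelyInseparable K L]

/-- Locally, the intersection of `B` with the fraction field of `A` is a localization of `A`. -/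
theorem exists_forall_pow_mul_mem_range (q : Ideal B) [q.IsPrime]
    (hzmt : ∃ r ∉ q, IsIntegral A r ∧ ∀ b : B, ∃ m : ℕ, IsIntegral A (r ^ m * b)) :
    ∃ g : A, algebraMap A B g ∉ q ∧ ∀ c ∈ fractionFieldInter A B K L, ∃ m : ℕ,
      algebraMap A B g ^ m * c ∈ (algebraMap A B).range := by
  obtain ⟨r, hrq, hr, hrb⟩ := hzmt
  have down {b : B} (hb : b ∈ fractionFieldInter A B K L) (hint : IsIntegral A b) :
      b ∈ (algebraMap A B).range := by
    obtain ⟨a, ha⟩ := mem_range_of_isIntegral_of_mem_range (A := A)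
      (mem_fractionFieldInter.mp hb) hint.algebraMap
    refine ⟨a, IsFractionRing.injective B L ?_⟩
    rw [← ha, ← IsScalarTower.algebraMap_apply]
  obtain ⟨n, hn⟩ := exists_pow_mem_fractionFieldInter (A := A) (K := K) (L := L)
    (ringExpChar K) r
  obtain ⟨g, hg⟩ := down hn (hr.pow _)
  refine ⟨g, fun h ↦ hrq ?_, fun c hc ↦ ?_⟩
  · rw [hg] at h
    exact Ideal.IsPrime.mem_of_pow_mem inferInstance _ h
  · obtain ⟨m, hm⟩ := hrb c
    refine ⟨m, down (mul_mem (pow_mem (algebraMap_mem _ g) _) hc) ?_⟩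
    have hpos := expChar_pow_pos K (ringExpChar K) n
    -- With `g = r ^ p ^ n`, one factor `r ^ m` of `g ^ m` makes `c` integral; the other `p ^ n - 1`
    -- are integral themselves.
    have : algebraMap A B g ^ m * c = (r ^ m) ^ (ringExpChar K ^ n - 1) * (r ^ m * c) := by
      rw [hg, ← mul_assoc, ← pow_succ, Nat.sub_add_cancel hpos, pow_right_comm]
    rw [this]
    exact ((hr.pow _).pow _).mul hm

/-- The intersection of `B` with the fraction field of `A` is integrally closed. -/
theorem mem_range_of_isIntegral_of_zariskisMain
    (hzmt : ∀ q : Ideal B, q.IsMaximal → ∃ r ∉ q, IsIntegral A r ∧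
      ∀ b : B, ∃ m : ℕ, IsIntegral A (r ^ m * b))
    {x : L} (hx : x ∈ (algebraMap K L).range) (hint : IsIntegral B x) :
    x ∈ (algebraMap B L).range := by
  have := isIntegral_fractionFieldInter (A := A) (B := B) (K := K) (L := L)
  -- Integrality is moved from `B` to `C` because powers of `g` carry only `C` into `A`.
  have hint' : IsIntegral (fractionFieldInter A B K L) x := isIntegral_trans x hint
  -- The ideal of denominators of `x`. A power of `g` lies in it, so no maximal ideal contains it.
  let J : Ideal B := (1 : Submodule B L).comap (LinearMap.toSpanSingleton B L x)
  have hJ (b : B) : b ∈ J ↔ ∃ y, algebraMap B L y = b • x := Submodule.mem_one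
  have hJ1 : J = ⊤ := by
    by_contra hne
    obtain ⟨q, hq, hJq⟩ := Ideal.exists_le_maximal J hne
    obtain ⟨g, hgq, hg⟩ := exists_forall_pow_mul_mem_range (K := K) (L := L) q (hzmt q hq)
    obtain ⟨N, hN⟩ := hint'.exists_pow_mul_of_forall_pow_mul_mem_range (R := A) g (fun c ↦ by
      obtain ⟨m, a, ha⟩ := hg c.1 c.2
      exact ⟨m, a, Subtype.ext ha⟩)
    obtain ⟨a, ha⟩ := mem_range_of_isIntegral_of_mem_range (A := A) (K := K)
      (mul_mem (pow_mem (RingHom.mem_range.mpr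
        ⟨algebraMap A K g, (IsScalarTower.algebraMap_apply A K L g).symm⟩) N) hx)
      hN
    refine hgq (hq.isPrime.mem_of_pow_mem N (hJq ((hJ _).mpr ⟨algebraMap A B a, ?_⟩)))
    rw [← IsScalarTower.algebraMap_apply, ha, Algebra.smul_def, map_pow,
      ← IsScalarTower.algebraMap_apply]
  obtain ⟨y, hy⟩ := (hJ 1).mp (hJ1 ▸ Submodule.mem_top)
  exact ⟨y, by rw [hy, one_smul]⟩

theorem exists_pow_mem_range_of_isIntegral (p : ℕ) [ExpChar K p]
    (hzmt : ∀ q : Ideal B, q.IsMaximal → ∃ r ∉ q, IsIntegral A r ∧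
      ∀ b : B, ∃ m : ℕ, IsIntegral A (r ^ m * b))
    {x : L} (hint : IsIntegral B x) : ∃ n : ℕ, x ^ p ^ n ∈ (algebraMap B L).range := by
  obtain ⟨n, hn⟩ := IsPurelyInseparable.pow_mem K p x
  exact ⟨n, mem_range_of_isIntegral_of_zariskisMain (A := A) hzmt hn (hint.pow _)⟩

/-- Primes of `C` lift to `B` by integrality, and the lift lies in a maximal ideal, where Zariski's
main theorem is available. -/
theorem exists_forall_pow_mul_mem_range_fractionFieldInter
    (hzmt : ∀ q : Ideal B, q.IsMaximal → ∃ r ∉ q, IsIntegral A r ∧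
      ∀ b : B, ∃ m : ℕ, IsIntegral A (r ^ m * b))
    (P : Ideal (fractionFieldInter A B K L)) [P.IsPrime] :
    ∃ g : A, algebraMap A _ g ∉ P ∧ ∀ c : fractionFieldInter A B K L, ∃ m : ℕ,
      algebraMap A _ g ^ m * c ∈ (algebraMap A (fractionFieldInter A B K L)).range := by
  have := isIntegral_fractionFieldInter (A := A) (B := B) (K := K) (L := L)
  obtain ⟨Q, -, hQ, hQP⟩ := Ideal.exists_ideal_over_prime_of_isIntegral (S := B) P ⊥ (by
    rw [← RingHom.ker_eq_comap_bot, (RingHom.injective_iff_ker_eq_bot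
      (algebraMap (fractionFieldInter A B K L) B)).mp Subtype.val_injective]
    exact bot_le)
  obtain ⟨q, hq, hQq⟩ := Ideal.exists_le_maximal Q hQ.ne_top
  obtain ⟨g, hgq, hg⟩ := exists_forall_pow_mul_mem_range (K := K) (L := L) q (hzmt q hq)
  refine ⟨g, fun h ↦ hgq (hQq ?_), fun c ↦ ?_⟩
  · rw [← hQP] at h
    exact h
  · obtain ⟨m, a, ha⟩ := hg c.1 c.2
    exact ⟨m, a, Subtype.ext ha⟩

end FractionFieldInter

/-! ### A criterion for open immersions -/

/-- An extension `R ⊆ S` that is locally on `Spec S` a localization at an element of `R` induces an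
open immersion. -/
theorem isOpenImmersion_SpecMap_of_forall_pow_mul_mem_range {R S : Type u} [CommRing R]
    [CommRing S] [Algebra R S] (hinj : Function.Injective (algebraMap R S))
    (h : ∀ P : Ideal S, P.IsPrime → ∃ g : R, algebraMap R S g ∉ P ∧
      ∀ s : S, ∃ m : ℕ, algebraMap R S g ^ m * s ∈ (algebraMap R S).range) :
    IsOpenImmersion (Spec.map (CommRingCat.ofHom (algebraMap R S))) := by
  refine IsOpenImmersion.of_forall_source_exists _ ?_ fun P ↦ ?_
  -- Injectivity: a prime is recovered from its contraction, since multiplying by a power of `g`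
  -- moves `s` into `R` and `g` lies in neither prime.
  · have key (P P' : PrimeSpectrum S)
        (hPP : P.asIdeal.comap (algebraMap R S) = P'.asIdeal.comap (algebraMap R S)) :
        P.asIdeal ≤ P'.asIdeal := by
      intro s hs
      obtain ⟨g, hgP, hg⟩ := h P.asIdeal P.2
      obtain ⟨m, a, ha⟩ := hg s
      have ha' : a ∈ P.asIdeal.comap (algebraMap R S) := by
        rw [Ideal.mem_comap, ha]; exact Ideal.mul_mem_left _ _ hs
      rw [hPP, Ideal.mem_comap, ha] at ha'
      refine (P'.2.mem_or_mem ha').resolve_left fun hm ↦ hgP ?_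
      have : g ∈ P'.asIdeal.comap (algebraMap R S) := P'.2.mem_of_pow_mem m hm
      rwa [← hPP] at this
    intro P P' hPP
    have hPP := congrArg PrimeSpectrum.asIdeal hPP
    exact PrimeSpectrum.ext (le_antisymm (key P P' hPP) (key P' P hPP.symm))
  · obtain ⟨g, hgP, hg⟩ := h P.asIdeal P.2
    let T := Localization.Away (algebraMap R S g)
    -- Inverting `g` identifies `R` with `S`.
    have hT : IsLocalization.Away g T := by
      have hu := IsLocalization.Away.algebraMap_isUnit (S := T) (algebraMap R S g)
      have htower := IsScalarTower.algebraMap_apply R S T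
      refine ⟨?_, ?_, ?_⟩
      · rintro ⟨_, n, rfl⟩
        rw [map_pow, htower]
        exact hu.pow n
      · intro z
        obtain ⟨n, s, hs⟩ := IsLocalization.Away.surj (algebraMap R S g) z
        obtain ⟨m, a, ha⟩ := hg s
        refine ⟨(a, ⟨g ^ (n + m), n + m, rfl⟩), ?_⟩
        change z * algebraMap R T (g ^ (n + m)) = algebraMap R T a
        rw [htower a, ha, map_mul, ← hs, htower, map_pow, map_pow, map_pow, pow_add]
        ring
      · intro x y hxy
        rw [htower, htower] at hxy
        obtain ⟨n, hn⟩ := IsLocalization.Away.exists_of_eq (algebraMap R S g) hxy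
        refine ⟨⟨g ^ n, n, rfl⟩, hinj ?_⟩
        simpa using hn
    refine ⟨Spec (CommRingCat.of T), Spec.map (CommRingCat.ofHom (algebraMap S T)),
      .of_isLocalization (algebraMap R S g), ?_, ?_⟩
    · have := PrimeSpectrum.localization_away_comap_range T (algebraMap R S g)
      exact (Set.ext_iff.mp this P).mpr hgP
    · rw [← Spec.map_comp, ← CommRingCat.ofHom_comp, ← IsScalarTower.algebraMap_eq]
      exact IsOpenImmersion.of_isLocalization (S := T) g

/-! ### Scheme points as ring homomorphisms -/

section Points

variable {k : Type u} [Field k]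

/-- The comorphism of the structure morphism of a `k`-scheme. -/
noncomputable def structureRingHom {X : Scheme.{u}} (s : X ⟶ Spec (CommRingCat.of k)) :
    CommRingCat.of k ⟶ Γ(X, ⊤) :=
  (Scheme.ΓSpecIso (CommRingCat.of k)).inv ≫ s.appTop

theorem structureRingHom_comp {X Y : Scheme.{u}} {s : X ⟶ Spec (CommRingCat.of k)}
    {t : Y ⟶ Spec (CommRingCat.of k)} {f : X ⟶ Y} (hf : f ≫ t = s) :
    structureRingHom t ≫ f.appTop = structureRingHom s := by
  rw [← hf, structureRingHom, structureRingHom, Scheme.Hom.comp_appTop, Category.assoc]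

theorem isoSpec_hom_SpecMap_structureRingHom {X : Scheme.{u}} [IsAffine X]
    (s : X ⟶ Spec (CommRingCat.of k)) :
    X.isoSpec.hom ≫ Spec.map (structureRingHom s) = s := by
  rw [structureRingHom, Spec.map_comp, Scheme.isoSpec_hom_naturality_assoc,
    Scheme.isoSpec_Spec_hom, ← Spec.map_comp, Iso.inv_hom_id, Spec.map_id, Category.comp_id]

/-- The `k`-point of an affine `k`-scheme given by a homomorphism from its coordinate ring. -/
noncomputable def KPoint.ofHom {X : Scheme.{u}} [IsAffine X] {s : X ⟶ Spec (CommRingCat.of k)}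
    (χ : Γ(X, ⊤) ⟶ CommRingCat.of k) (h : structureRingHom s ≫ χ = 𝟙 _) : KPoint s :=
  ⟨Spec.map χ ≫ X.isoSpec.inv, by
    conv_lhs => rw [← isoSpec_hom_SpecMap_structureRingHom s]
    rw [Category.assoc, Iso.inv_hom_id_assoc, ← Spec.map_comp, h, Spec.map_id]⟩

theorem KPoint.ofHom_injective {X : Scheme.{u}} [IsAffine X] {s : X ⟶ Spec (CommRingCat.of k)}
    {χ ξ : Γ(X, ⊤) ⟶ CommRingCat.of k} {hχ : structureRingHom s ≫ χ = 𝟙 _}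
    {hξ : structureRingHom s ≫ ξ = 𝟙 _}
    (h : KPoint.ofHom (s := s) χ hχ = KPoint.ofHom (s := s) ξ hξ) : χ = ξ := by
  have h : Spec.map χ ≫ X.isoSpec.inv = Spec.map ξ ≫ X.isoSpec.inv := congrArg Subtype.val h
  rw [cancel_mono] at h
  exact Spec.map_injective h

theorem KPoint.map_ofHom {X Y : Scheme.{u}} [IsAffine X] [IsAffine Y]
    {s : X ⟶ Spec (CommRingCat.of k)} {t : Y ⟶ Spec (CommRingCat.of k)} (f : X ⟶ Y)
    (hf : f ≫ t = s) (χ : Γ(X, ⊤) ⟶ CommRingCat.of k) (h : structureRingHom s ≫ χ = 𝟙 _) :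
    (KPoint.ofHom (s := s) χ h).map f hf = KPoint.ofHom (s := t) (f.appTop ≫ χ) (by
      rw [← Category.assoc, structureRingHom_comp hf, h]) := by
  refine Subtype.ext ?_
  change (Spec.map χ ≫ X.isoSpec.inv) ≫ f = Spec.map (f.appTop ≫ χ) ≫ Y.isoSpec.inv
  rw [Spec.map_comp, Category.assoc, Category.assoc, Scheme.isoSpec_inv_naturality]

theorem KPoint.toPoint_ofHom_mem {X : Scheme.{u}} [IsAffine X]
    {s : X ⟶ Spec (CommRingCat.of k)} (χ : Γ(X, ⊤) ⟶ CommRingCat.of k)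
    (h : structureRingHom s ≫ χ = 𝟙 _) {g : Γ(X, ⊤)} {V : X.Opens}
    (hgV : PrimeSpectrum.basicOpen g ≤ X.isoSpec.inv ⁻¹ᵁ V)
    (hg : χ.hom g ≠ 0) : (KPoint.ofHom (s := s) χ h).toPoint ∈ V := by
  have : Spec.map χ (IsLocalRing.closedPoint k) ∈ X.isoSpec.inv ⁻¹ᵁ V := by
    refine hgV ?_
    change χ.hom g ∉ IsLocalRing.maximalIdeal k
    rwa [IsLocalRing.maximalIdeal_eq_bot]
  exact this

theorem KPoint.map_bijective_comp {X Y Z : Scheme.{u}} {s : X ⟶ Spec (CommRingCat.of k)}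
    {t : Y ⟶ Spec (CommRingCat.of k)} {r : Z ⟶ Spec (CommRingCat.of k)} (f : X ⟶ Y) (g : Y ⟶ Z)
    (hf : f ≫ t = s) (hg : g ≫ r = t) (hfg : (f ≫ g) ≫ r = s)
    (hfb : Function.Bijective (KPoint.map f hf)) (hgb : Function.Bijective (KPoint.map g hg)) :
    Function.Bijective (KPoint.map (f ≫ g) hfg) := by
  have : KPoint.map (f ≫ g) hfg = KPoint.map g hg ∘ KPoint.map f hf :=
    funext fun p ↦ Subtype.ext (Category.assoc _ _ _).symm
  rw [this]
  exact hgb.comp hfb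

theorem KPoint.map_bijective_of_isIso {X Y : Scheme.{u}} {s : X ⟶ Spec (CommRingCat.of k)}
    {t : Y ⟶ Spec (CommRingCat.of k)} (f : X ⟶ Y) [IsIso f] (hf : f ≫ t = s) :
    Function.Bijective (KPoint.map f hf) := by
  refine ⟨fun p q h ↦ Subtype.ext ?_, fun q ↦ ⟨⟨q.1 ≫ inv f, ?_⟩, Subtype.ext ?_⟩⟩
  · have h : p.1 ≫ f = q.1 ≫ f := congrArg Subtype.val h
    rwa [cancel_mono] at h
  · rw [← hf, Category.assoc, IsIso.inv_hom_id_assoc, q.2]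
  · change (q.1 ≫ inv f) ≫ f = q.1
    rw [Category.assoc, IsIso.inv_hom_id, Category.comp_id]

/-- An extension of rings `R ⊆ S` such that every element of `S` has a power, with exponent a power
of the characteristic exponent, in `R` induces a bijection on `k`-points. -/
theorem KPoint.map_SpecMap_bijective [IsAlgClosed k] (p : ℕ) [ExpChar k p] {R S : CommRingCat.{u}}
    (f : R ⟶ S) {s : Spec S ⟶ Spec (CommRingCat.of k)} {t : Spec R ⟶ Spec (CommRingCat.of k)}
    (hf : Spec.map f ≫ t = s) (hinj : Function.Injective f.hom)
    (hpow : ∀ x : S, ∃ n : ℕ, x ^ p ^ n ∈ f.hom.range) :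
    Function.Bijective (KPoint.map (Spec.map f) hf) := by
  obtain ⟨ι, rfl⟩ := Spec.map_surjective t
  obtain rfl : Spec.map (ι ≫ f) = s := by rw [Spec.map_comp, hf]
  let : Algebra k R := ι.hom.toAlgebra
  let : Algebra k S := (ι ≫ f).hom.toAlgebra
  let f' : R →ₐ[k] S := ⟨f.hom, fun c ↦ rfl⟩
  have key := bijective_comp_of_pow_mem_range p f' hinj hpow
  constructor
  · rintro ⟨a, ha⟩ ⟨b, hb⟩ h
    have h : a ≫ Spec.map f = b ≫ Spec.map f := congrArg Subtype.val h
    obtain ⟨a, rfl⟩ := Spec.map_surjective a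
    obtain ⟨b, rfl⟩ := Spec.map_surjective b
    rw [← Spec.map_comp, ← Spec.map_id, Spec.map_inj] at ha hb
    rw [← Spec.map_comp, ← Spec.map_comp, Spec.map_inj] at h
    let a' : S →ₐ[k] k := ⟨a.hom, fun c ↦ congr($(ha).hom c)⟩
    let b' : S →ₐ[k] k := ⟨b.hom, fun c ↦ congr($(hb).hom c)⟩
    have : a' = b' := key.1 (AlgHom.ext fun x ↦ congr($(h).hom x))
    have : a = b := CommRingCat.hom_ext (congrArg AlgHom.toRingHom this)
    subst this
    rfl
  · rintro ⟨a, ha⟩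
    obtain ⟨a, rfl⟩ := Spec.map_surjective a
    rw [← Spec.map_comp, ← Spec.map_id, Spec.map_inj] at ha
    let a' : R →ₐ[k] k := ⟨a.hom, fun c ↦ congr($(ha).hom c)⟩
    obtain ⟨b', hb'⟩ := key.2 a'
    have hb : f ≫ CommRingCat.ofHom (R := S) b'.toRingHom = a :=
      CommRingCat.hom_ext (congrArg AlgHom.toRingHom hb')
    refine ⟨⟨Spec.map (CommRingCat.ofHom b'.toRingHom), ?_⟩, Subtype.ext ?_⟩
    · rw [← Spec.map_comp, Category.assoc, hb, ha, Spec.map_id]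
    · change Spec.map _ ≫ Spec.map f = _
      rw [← Spec.map_comp, hb]

end Points

/-! ### From geometric hypotheses to coordinate rings -/

/-- The coordinate ring of a normal irreducible affine scheme is integrally closed. -/
theorem IsNormalScheme.isIntegrallyClosed {Y : Scheme.{u}} [IsAffine Y]
    [AlgebraicGeometry.IsIntegral Y] (h : IsNormalScheme Y) : IsIntegrallyClosed Γ(Y, ⊤) := by
  refine IsIntegrallyClosed.of_localization_maximal fun P _ hP ↦ ?_
  let z : Spec Γ(Y, ⊤) := ⟨P, hP.isPrime⟩
  have hU := isAffineOpen_top Y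
  let : Algebra Γ(Y, ⊤) (Y.presheaf.stalk (hU.fromSpec z)) :=
    TopCat.Presheaf.algebra_section_stalk Y.presheaf (U := ⊤) ⟨hU.fromSpec z, trivial⟩
  have hloc : IsLocalization.AtPrime (Y.presheaf.stalk (hU.fromSpec z)) P :=
    hU.isLocalization_stalk' z trivial
  have := (h (hU.fromSpec z)).2
  exact IsIntegrallyClosed.of_equiv
    (IsLocalization.algEquiv P.primeCompl (Y.presheaf.stalk (hU.fromSpec z))
      (Localization.AtPrime P)).toRingEquiv

theorem IsDominant.appTop_injective {X Y : Scheme.{u}} [IsAffine X] [IsAffine Y] [IsReduced Y]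
    (f : X ⟶ Y) [IsDominant f] : Function.Injective f.appTop.hom := by
  have := IsSchemeTheoreticallyDominant.of_isDominant f
  exact f.app_injective ⊤

theorem finiteType_structureRingHom {k : Type u} [Field k] {X : Scheme.{u}} [IsAffine X]
    (s : X ⟶ Spec (CommRingCat.of k)) [LocallyOfFiniteType s] :
    (structureRingHom s).hom.FiniteType := by
  have : (Spec.map (structureRingHom s)) = X.isoSpec.inv ≫ s := by
    rw [Iso.eq_inv_comp, isoSpec_hom_SpecMap_structureRingHom]
  rw [← HasRingHomProperty.Spec_iff (P := @LocallyOfFiniteType), this]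
  infer_instance

theorem exists_ne_zero_basicOpen_subset {R : Type u} [CommRing R] [IsDomain R]
    {V : Set (PrimeSpectrum R)} (hV : IsOpen V) (hne : V.Nonempty) :
    ∃ g : R, g ≠ 0 ∧ (PrimeSpectrum.basicOpen g : Set (PrimeSpectrum R)) ⊆ V := by
  obtain ⟨x, hx⟩ := hne
  obtain ⟨_, ⟨g, rfl⟩, hxg, hgV⟩ :=
    PrimeSpectrum.isTopologicalBasis_basic_opens.exists_subset_of_mem_open hx hV
  refine ⟨g, ?_, hgV⟩
  rintro rfl
  exact hxg x.asIdeal.zero_mem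

/-! ### Assembly -/

theorem mainTheorem9 {k : Type u} [Field k] [IsAlgClosed k] {X Y : Scheme.{u}}
    (sX : X ⟶ Spec (CommRingCat.of k)) (sY : Y ⟶ Spec (CommRingCat.of k))
    [IsAffine X] [AlgebraicGeometry.IsIntegral X] [LocallyOfFiniteType sX]
    [IsAffine Y] [AlgebraicGeometry.IsIntegral Y] [LocallyOfFiniteType sY]
    (φ : X ⟶ Y) (hφ : φ ≫ sY = sX)
    (hdominant : IsDominant φ)
    (hquasifinite : ∀ y : KPoint sY, (KPoint.fibre φ hφ y).Finite)
    (hnormal : IsNormalScheme Y)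
    (hgeneric : ∃ V : Y.Opens, Dense (V : Set Y) ∧
      ∀ y : KPoint sY, y.toPoint ∈ V → ∃ x : KPoint sX, KPoint.fibre φ hφ y = {x}) :
    (∃ (U : Y.Opens) (ψ : X ⟶ U.toScheme) (hψ : ψ ≫ U.ι = φ),
      IsAffineOpen U ∧ IsFinite ψ ∧
      Function.Bijective (KPoint.map (s := sX) (t := U.ι ≫ sY) ψ
        (by rw [← Category.assoc, hψ, hφ]))) ∧
    Function.Bijective (KPoint.map (s := affineNormalizationMap X ≫ sX) (t := sX)
      (affineNormalizationMap X) rfl) := by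
  let A : Type u := Γ(Y, ⊤)
  let B : Type u := Γ(X, ⊤)
  let L : Type u := X.functionField
  let K : Type u := FractionRing A
  have : IsIntegrallyClosed A := hnormal.isIntegrallyClosed
  let : Algebra A B := φ.appTop.hom.toAlgebra
  let : Algebra k A := (structureRingHom sY).hom.toAlgebra
  let : Algebra k B := (structureRingHom sX).hom.toAlgebra
  have hcomp := structureRingHom_comp hφ
  have : IsScalarTower k A B := .of_algebraMap_eq fun c ↦ congr($(hcomp.symm).hom c)
  have : Algebra.FiniteType k B := finiteType_structureRingHom sX
  have hinj : Function.Injective (algebraMap A B) := IsDominant.appTop_injective φ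
  have : IsFractionRing B L := functionField_isFractionRing_of_isAffineOpen X ⊤ (isAffineOpen_top X)
  let : Algebra A L := ((algebraMap B L).comp (algebraMap A B)).toAlgebra
  have : IsScalarTower A B L := .of_algebraMap_eq fun _ ↦ rfl
  have : FaithfulSMul A L := (faithfulSMul_iff_algebraMap_injective A L).mpr
    ((IsFractionRing.injective B L).comp hinj)
  let : Algebra K L := FractionRing.liftAlgebra A L
  have : IsScalarTower A K L := FractionRing.isScalarTower_liftAlgebra A L
  -- Points of `X` and `Y` given by homomorphisms from the coordinate rings.
  have hX (x : B →ₐ[k] k) :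
      structureRingHom sX ≫ CommRingCat.ofHom (R := Γ(X, ⊤)) x.toRingHom = 𝟙 _ :=
    CommRingCat.hom_ext (RingHom.ext x.commutes)
  have hY (y : A →ₐ[k] k) :
      structureRingHom sY ≫ CommRingCat.ofHom (R := Γ(Y, ⊤)) y.toRingHom = 𝟙 _ :=
    CommRingCat.hom_ext (RingHom.ext y.commutes)
  let P (x : B →ₐ[k] k) : KPoint sX := KPoint.ofHom _ (hX x)
  let Q (y : A →ₐ[k] k) : KPoint sY := KPoint.ofHom _ (hY y)
  have hP : Function.Injective P := fun x x' h ↦ by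
    have := congrArg CommRingCat.Hom.hom (KPoint.ofHom_injective h)
    exact AlgHom.ext fun b ↦ RingHom.congr_fun this b
  have hPQ (x : B →ₐ[k] k) (y : A →ₐ[k] k) (h : ∀ a, x (algebraMap A B a) = y a) :
      P x ∈ KPoint.fibre φ hφ (Q y) := by
    change KPoint.map φ hφ (KPoint.ofHom _ (hX x)) = KPoint.ofHom _ (hY y)
    rw [KPoint.map_ofHom]
    congr 1
    exact CommRingCat.hom_ext (RingHom.ext h)
  have hfin (y : A →ₐ[k] k) : {x : B →ₐ[k] k | ∀ a, x (algebraMap A B a) = y a}.Finite :=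
    ((hquasifinite (Q y)).preimage hP.injOn).subset fun x hx ↦ hPQ x y hx
  obtain ⟨V, hVd, hV⟩ := hgeneric
  obtain ⟨v, hv⟩ := hVd.nonempty
  obtain ⟨g, hg, hgV⟩ := exists_ne_zero_basicOpen_subset (R := A)
    (Y.isoSpec.inv ⁻¹ᵁ V).2 ⟨Y.isoSpec.hom v, by
      change Y.isoSpec.inv (Y.isoSpec.hom v) ∈ V
      rwa [← Scheme.Hom.comp_apply, Iso.hom_inv_id]⟩
  have : IsPurelyInseparable K L := by
    refine isPurelyInseparable_of_generically_injective (k := k) hinj g hg fun x x' h hx ↦ hP ?_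
    let y : A →ₐ[k] k := x.comp (IsScalarTower.toAlgHom k A B)
    obtain ⟨z, hz⟩ := hV (Q y) (KPoint.toPoint_ofHom_mem _ (hY y) hgV hx)
    have h₁ := hPQ x y fun _ ↦ rfl
    have h₂ := hPQ x' y fun a ↦ (h a).symm
    rw [hz] at h₁ h₂
    exact h₁.trans h₂.symm
  have hzmt (q : Ideal B) (hq : q.IsMaximal) :=
    exists_isIntegral_of_finite_fibres (A := A) hfin q
  obtain ⟨p, hp⟩ := ExpChar.exists k
  have : ExpChar K p := expChar_of_injective_algebraMap
    (R := k) ((algebraMap A K).comp (algebraMap k A)).injective p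
  let C := fractionFieldInter A B K L
  have : Algebra.IsIntegral C B := isIntegral_fractionFieldInter
  have hj := isOpenImmersion_SpecMap_of_forall_pow_mul_mem_range (R := A) (S := C)
    (fun a b h ↦ hinj (congrArg Subtype.val h))
    fun P _ ↦ exists_forall_pow_mul_mem_range_fractionFieldInter hzmt P
  refine ⟨?_, ?_⟩
  -- `U` is the image of the open immersion `j`, and `X → U` is `f` up to isomorphisms.
  · let j : Spec (CommRingCat.of C) ⟶ Y :=
      Spec.map (CommRingCat.ofHom (algebraMap A C)) ≫ Y.isoSpec.inv
    let f : Spec Γ(X, ⊤) ⟶ Spec (CommRingCat.of C) := Spec.map (CommRingCat.ofHom (algebraMap C B))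
    have hψ : (X.isoSpec.hom ≫ f ≫ j.isoOpensRange.hom) ≫ j.opensRange.ι = φ := by
      have hfj : f ≫ Spec.map (CommRingCat.ofHom (algebraMap A C)) = Spec.map φ.appTop :=
        (Spec.map_comp _ _).symm
      rw [Category.assoc, Category.assoc, Scheme.Hom.isoOpensRange_hom_ι, reassoc_of% hfj,
        Scheme.isoSpec_hom_naturality_assoc, Iso.hom_inv_id, Category.comp_id]
    refine ⟨j.opensRange, _, hψ, isAffineOpen_opensRange j, ?_, ?_⟩
    · have : Algebra.FiniteType A B := .of_restrictScalars_finiteType k A B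
      have : Algebra.FiniteType C B := .of_restrictScalars_finiteType A C B
      have : IsFinite f := by
        rw [IsFinite.SpecMap_iff]
        exact RingHom.finite_algebraMap.mpr Algebra.IsIntegral.finite
      infer_instance
    · have hjt : j.isoOpensRange.hom ≫ j.opensRange.ι ≫ sY = j ≫ sY := by
        rw [Scheme.Hom.isoOpensRange_hom_ι_assoc]
      refine KPoint.map_bijective_comp (t := X.isoSpec.inv ≫ sX) _ _
        (Iso.hom_inv_id_assoc _ _) ?_ _ (KPoint.map_bijective_of_isIso _ _)
        (KPoint.map_bijective_comp (t := j ≫ sY) _ _ ?_ hjt _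
          (KPoint.map_SpecMap_bijective p _ _ Subtype.val_injective fun b ↦ ?_)
          (KPoint.map_bijective_of_isIso _ _))
      · rw [Iso.eq_inv_comp, ← hφ, ← hψ]
        simp only [Category.assoc]
      · rw [Iso.eq_inv_comp, ← hφ, ← hψ, ← hjt]
        simp only [Category.assoc]
      · obtain ⟨n, hn⟩ := exists_pow_mem_fractionFieldInter (A := A) (K := K) (L := L) p b
        exact ⟨n, ⟨_, hn⟩, rfl⟩
  · refine KPoint.map_bijective_comp (t := X.isoSpec.inv ≫ sX) _ _ ?_ rfl _
      (KPoint.map_SpecMap_bijective p _ _ ?_ fun x ↦ ?_) (KPoint.map_bijective_of_isIso _ _)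
    · exact (Category.assoc _ _ _).symm
    · exact fun a b h ↦ IsFractionRing.injective B L (congrArg Subtype.val h)
    · obtain ⟨n, b, hb⟩ := exists_pow_mem_range_of_isIntegral (A := A) (K := K) p hzmt x.2
      exact ⟨n, b, Subtype.ext hb⟩
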